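/- Let $\mathscr{A}$ be a complex Banach $^*$-algebra, not necessarily unital and with a not necessarily continuous involution (i.e. a $^*$-algebra with a complete submultiplicative norm), and let $\overline{\mathscr{A}}'$ be its antidual, i.e. the Banach space of continuous conjugate-linear functionals $\varphi:\mathscr{A}\to\mathbb{C}$, with pairing $\langle \varphi,x\rangle=\varphi(x)$. For $\varphi\in\overline{\mathscr{A}}'$ let $\overline{\varphi}\in\mathscr{A}'$ be the functional $x\mapsto\overline{\varphi(x)}$. Let $\mathscr{M}\subseteq\mathscr{A}$ be a left ideal (a linear subspace with $xa\in\mathscr{M}$ for $x\in\mathscr{A}$, $a\in\mathscr{M}$) and let $f:\mathscr{M}\to\mathbb{C}$ be a linear functional such that, for some constant $C\ge 0$, $$|f(a)|^2\le C\, f(a^*a)\qquad\text{for all } a\in\mathscr{M},$$ where the inequality includes that the right-hand side is real. Assume further that there is a norm bounded net $(e_i)_{i\in I}$ in $\mathscr{A}$ with $\lim_i e_i a=a$ in norm for all $a\in\mathscr{M}$. Then: (1) For each $a\in\mathscr{M}$ the functional $Aa: x\mapsto f(x^*a)$ on $\mathscr{A}$ is continuous, so that $A:\mathscr{M}\to\overline{\mathscr{A}}'$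 is a well-defined linear operator. It has a unique Krein--von Neumann extension $A_N$, that is, a smallest bounded positive extension: $A_N:\mathscr{A}\to\overline{\mathscr{A}}'$ is bounded and linear, $\langle A_Nx,x\rangle\ge0$ for all $x\in\mathscr{A}$, $A_N$ extends $A$, and $\langle A_Nx,x\rangle\le\langle Bx,x\rangle$ for all $x\in\mathscr{A}$ and every bounded linear operator $B:\mathscr{A}\to\overline{\mathscr{A}}'$ that extends $A$ and satisfies $\langle By,y\rangle\ge 0$ for all $y\in\mathscr{A}$. (2) $f$ has a unique minimal representable extension $f_N$. Here a functional $g\in\mathscr{A}'$ with $g(x^*x)\ge 0$ for all $x\in\mathscr{A}$ is called representable if there are a $^*$-representation $\pi$ of $\mathscr{A}$ by bounded operators on a complex Hilbert space and a vector $\zeta$ in that space with $g(x)=(\pi(x)\zeta\,|\,\zeta)$ for all $x\in\mathscr{A}$; and $f_N$ is minimal in the sense that it is a representable extension of $f$ and $f_N(x^*x)\le g(x^*x)$ for all $x\in\mathscr{A}$ and every representable extension $g\in\mathscr{A}'$ of $f$. (3) The net $(A_Ne_i)_{i\in I}$ converges in the norm of $\overline{\mathscr{A}}'$, the conjugate of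 its limit is $f_N$, and $$f_N=\lim_{i}\overline{A_Ne_i}$$ in the norm of $\mathscr{A}'$. -/

import Mathlib

open Filter Topology
open scoped ComplexOrder

universe u

/- Inequalities between complex numbers are meant in the usual partial order of `ℂ`:
`z ≤ w` says that `w - z` is a nonnegative real number. -/

section Operators

variable {E : Type*} [NormedAddCommGroup E] [NormedSpace ℂ E]

variable (E) in
/-- The antidual of `E`: the continuous conjugate-linear functionals on `E`, with the functional
norm. The pairing of `φ` and `x` is the value `φ x`. -/
abbrev AntiDual : Type _ := E →L⋆[ℂ] ℂ

/-- The conjugate `x ↦ conj (φ x)` of a functional in the antidual, an element of the dual. -/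
noncomputable def AntiDual.conj (φ : AntiDual E) : StrongDual ℂ E :=
  ((starL ℂ : ℂ ≃L⋆[ℂ] ℂ) : ℂ →L⋆[ℂ] ℂ).comp φ

theorem AntiDual.conj_apply (φ : AntiDual E) (x : E) : φ.conj x = star (φ x) := rfl

/-- Positivity of an everywhere defined bounded operator from `E` into its antidual. -/
def IsPositiveOp (B : E →L[ℂ] AntiDual E) : Prop :=
  ∀ x : E, 0 ≤ B x x

/-- `B` is a bounded positive extension to `E` of the operator `A` with domain `D`. -/
def IsPositiveExtension {D : Submodule ℂ E} (A : D →ₗ[ℂ] AntiDual E)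
    (B : E →L[ℂ] AntiDual E) : Prop :=
  IsPositiveOp B ∧ ∀ a : D, B (a : E) = A a

/-- `B` is the Krein-von Neumann extension of `A`: the smallest bounded positive extension of `A`
to `E`, where `B ≤ B'` means that `B x x ≤ B' x x` for all `x`. -/
def IsKreinVonNeumannExtension {D : Submodule ℂ E} (A : D →ₗ[ℂ] AntiDual E)
    (B : E →L[ℂ] AntiDual E) : Prop :=
  IsPositiveExtension A B ∧
    ∀ B' : E →L[ℂ] AntiDual E, IsPositiveExtension A B' → ∀ x : E, B x x ≤ B' x x

end Operators

section Functionals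

variable {𝔄 : Type u} [NonUnitalNormedRing 𝔄] [NormedSpace ℂ 𝔄]

/-- A linear subspace that is a left ideal of the (not necessarily unital) algebra. -/
def IsLeftIdeal (M : Submodule ℂ 𝔄) : Prop :=
  ∀ x : 𝔄, ∀ a ∈ M, x * a ∈ M

variable [StarRing 𝔄] [StarModule ℂ 𝔄]

/-- The operator `a ↦ (x ↦ f (x* a))` from the left ideal `M` into the antidual of the algebra,
for a linear functional `f` on `M` such that each functional `x ↦ f (x* a)` is continuous. -/
def inducedOperator [IsScalarTower ℂ 𝔄 𝔄] [SMulCommClass ℂ 𝔄 𝔄]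
    {M : Submodule ℂ 𝔄} (hM : IsLeftIdeal M) (f : M →ₗ[ℂ] ℂ)
    (hf : ∀ a : M, Continuous fun x : 𝔄 => f ⟨star x * a, hM (star x) a a.2⟩) :
    M →ₗ[ℂ] AntiDual 𝔄 where
  toFun a :=
    { toFun := fun x => f ⟨star x * a, hM (star x) a a.2⟩
      map_add' := fun x y => by
        rw [← map_add]; congr 1; ext; simp [add_mul]
      map_smul' := fun c x => by
        rw [← map_smul]; congr 1; ext; simp [smul_mul_assoc]
      cont := hf a }
  map_add' a b := by
    ext x
    change f _ = f _ + f _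
    rw [← map_add]; congr 1; ext; simp [mul_add]
  map_smul' c a := by
    ext x
    change f _ = c • f _
    rw [← map_smul]; congr 1; ext; simp [mul_smul_comm]

/-- A continuous positive functional `g` on the algebra is representable if
`g x = (π x ζ | ζ)` for some star-representation `π` by bounded operators on a complex Hilbert
space and some vector `ζ`. (Mathlib's inner product is linear in the second variable. Hilbert
spaces in the universe of the algebra suffice, since `π` and `ζ` can be compressed to the closure
of `{π x ζ}`, which is isometric to a completion of a quotient of the algebra.) -/
def IsRepresentable (g : StrongDual ℂ 𝔄) : Prop :=
  (∀ x : 𝔄, 0 ≤ g (star x * x)) ∧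
    ∃ (H : Type u) (_ : NormedAddCommGroup H) (_ : InnerProductSpace ℂ H) (_ : CompleteSpace H)
      (π : 𝔄 →⋆ₙₐ[ℂ] (H →L[ℂ] H)) (ζ : H), ∀ x : 𝔄, g x = inner ℂ ζ (π x ζ)

/-- `g` is a representable positive functional on the whole algebra extending `f`. -/
def IsRepresentableExtension {M : Submodule ℂ 𝔄} (f : M →ₗ[ℂ] ℂ) (g : StrongDual ℂ 𝔄) : Prop :=
  IsRepresentable g ∧ ∀ a : M, g (a : 𝔄) = f a

/-- `g` is the minimal representable extension of `f`. -/
def IsMinimalRepresentableExtension {M : Submodule ℂ 𝔄} (f : M →ₗ[ℂ] ℂ)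
    (g : StrongDual ℂ 𝔄) : Prop :=
  IsRepresentableExtension f g ∧
    ∀ g' : StrongDual ℂ 𝔄, IsRepresentableExtension f g' →
      ∀ x : 𝔄, g (star x * x) ≤ g' (star x * x)

end Functionals

/-! The GNS construction is run on the left ideal `M` itself, with semi-inner product `f (b* a)`.
Left multiplication by `x` is bounded for it because a small multiple of `x* x` can be written `2u -
u²` with `u` self-adjoint (Ford's lemma, `exists_selfAdjoint_quasi_sqrt`). This gives a
representation `π` on a Hilbert space `H` and a map `j : M → H` with dense range. The bound on `|f
a|²` makes `f` a bounded functional of `j a`, so Riesz supplies `ζ` with `f a = (j a | ζ)`, and then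
`π a ζ = j a`.

The extensions are `⟨A_N x, y⟩ = (π x ζ | π y ζ)` and `f_N x = (π x ζ | ζ)`. Both have quadratic
form `‖π x ζ‖²`, the supremum of `|f (x* a)|²` over `a ∈ M` with `f (a* a) ≤ 1`. Cauchy-Schwarz
bounds this by the form of any competitor (`norm_sq_le`).

Finally `A_N (e i)` is the image of `π (e i) ζ` under a bounded map, and `π (e i) → 1` strongly.
Continuity of `π`, needed here and for boundedness of `A_N`, is automatic (`exists_norm_map_le`)
even when the involution is discontinuous. -/

/-! ### Ford's square root lemma. -/

section SquareRoot

variable {A : Type*} [NonUnitalNormedRing A] [NormedSpace ℂ A]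
  [IsScalarTower ℂ A A] [SMulCommClass ℂ A A]

/-- A quasi-square root: `1 - h = (1 - u) ^ 2` for small `h`, written without a unit. -/
theorem exists_quasi_sqrt [CompleteSpace A] (h : A) (hh : ‖h‖ ≤ 3 / 4) :
    ∃ u : A, ‖u‖ ≤ 1 / 2 ∧ u + u - u * u = h ∧ ∀ y, Commute y h → Commute y u := by
  let F : A → A := fun u => (1 / 2 : ℂ) • (h + u * u)
  -- A contraction argument for `u = (h + u²) / 2`: the ball is preserved since `(3/4 + 1/4) / 2 =
  -- 1/2`. The commutation clause is closed and preserved by `F`, so the fixed point inherits it.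
  let S : Set A := {u | ‖u‖ ≤ 1 / 2 ∧ ∀ y, Commute y h → y * u = u * y}
  have hS : IsClosed S := by
    refine (isClosed_le continuous_norm continuous_const).inter ?_
    have e : {u : A | ∀ y, Commute y h → y * u = u * y} =
        ⋂ y, ⋂ _ : Commute y h, {u | y * u = u * y} := by ext; simp
    have hc : IsClosed (⋂ y, ⋂ _ : Commute y h, {u | y * u = u * y}) :=
      isClosed_iInter fun y => isClosed_iInter fun _ =>
        isClosed_eq (continuous_const.mul continuous_id) (continuous_id.mul continuous_const)
    rw [← e] at hc
    exact hc
  have hmaps : Set.MapsTo F S S := by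
    rintro u ⟨hu, hc⟩
    refine ⟨?_, fun y hy => ?_⟩
    · have h1 : ‖u * u‖ ≤ 1 / 4 := (norm_mul_le u u).trans (by nlinarith [norm_nonneg u])
      have h2 := norm_add_le h (u * u)
      simp only [F, norm_smul]
      norm_num
      linarith
    · have hyu : Commute y u := hc y hy
      exact ((hy.add_right (hyu.mul_right hyu)).smul_right _ : Commute y (F u))
  have hcontr : ContractingWith (1 / 2) (hmaps.restrict F S S) := by
    refine ⟨by rw [← NNReal.coe_lt_coe]; norm_num, LipschitzWith.of_dist_le_mul ?_⟩
    rintro ⟨u, hu⟩ ⟨v, hv⟩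
    simp only [Subtype.dist_eq, Set.MapsTo.val_restrict_apply, dist_eq_norm]
    have e : F u - F v = (1 / 2 : ℂ) • (u * (u - v) + (u - v) * v) := by
      simp only [F, ← smul_sub]; congr 1; noncomm_ring
    have h1 := norm_add_le (u * (u - v)) ((u - v) * v)
    have h2 := norm_mul_le u (u - v)
    have h3 := norm_mul_le (u - v) v
    have h4 : ‖u‖ ≤ 1 / 2 := hu.1
    have h5 : ‖v‖ ≤ 1 / 2 := hv.1
    rw [e, norm_smul]
    norm_num
    nlinarith [norm_nonneg (u - v)]
  obtain ⟨u, hu, hfix, -⟩ := hcontr.exists_fixedPoint' hS.isComplete hmaps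
    (x := 0) ⟨by norm_num, by simp⟩ (edist_ne_top _ _)
  refine ⟨u, hu.1, ?_, hu.2⟩
  have hfix' : (1 / 2 : ℂ) • (h + u * u) = u := hfix
  have : h + u * u = u + u := by
    rw [← two_smul ℂ u]
    nth_rw 3 [← hfix']
    rw [smul_smul]; norm_num
  rw [← this]; abel

/-- The `ℓ¹` unitization is a unital Banach algebra containing `A` isometrically; spectral estimates
are made there. -/
instance unitizationL1_normOneClass : NormOneClass (WithLp 1 (Unitization ℂ A)) where
  norm_one := by
    rw [WithLp.unitization_norm_def]
    change ‖(1 : Unitization ℂ A).fst‖ + ‖(1 : Unitization ℂ A).snd‖ = 1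
    simp

theorem spectrum_toLp_inr (x : A) :
    spectrum ℂ (WithLp.toLp 1 (x : Unitization ℂ A)) = spectrum ℂ (x : Unitization ℂ A) :=
  (AlgEquiv.spectrum_eq (WithLp.unitizationAlgEquiv (𝕜 := ℂ) (A := A) ℂ)
    (WithLp.toLp 1 (x : Unitization ℂ A))).symm

theorem norm_le_of_mem_spectrum_inr [CompleteSpace A] {x : A} {k : ℂ}
    (hk : k ∈ spectrum ℂ (x : Unitization ℂ A)) : ‖k‖ ≤ ‖x‖ := by
  rw [← spectrum_toLp_inr] at hk
  simpa [WithLp.unitization_norm_inr] using spectrum.norm_le_norm_of_mem hk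

theorem mem_spectrum_star [StarRing A] [StarModule ℂ A] {x : A} {k : ℂ}
    (hk : k ∈ spectrum ℂ ((star x : A) : Unitization ℂ A)) :
    star k ∈ spectrum ℂ (x : Unitization ℂ A) := by
  rw [spectrum.mem_iff] at hk ⊢
  contrapose! hk
  have := hk.star
  rwa [star_sub, ← algebraMap_star_comm, star_star, ← Unitization.inr_star] at this

theorem eventually_norm_toLp_pow_le_one [CompleteSpace A] (w : A)
    (hw : ∀ k ∈ spectrum ℂ (w : Unitization ℂ A), ‖k‖ ≤ 1 / 2) :
    ∀ᶠ n : ℕ in atTop, ‖(WithLp.toLp 1 (w : Unitization ℂ A)) ^ n‖ ≤ 1 := by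
  set W : WithLp 1 (Unitization ℂ A) := WithLp.toLp 1 (w : Unitization ℂ A)
  have hr : spectralRadius ℂ W < 1 := by
    refine lt_of_le_of_lt (b := ((1 / 2 : NNReal) : ENNReal)) ?_ ?_
    · refine iSup₂_le fun k hk => ?_
      rw [spectrum_toLp_inr] at hk
      have := hw k hk
      rw [ENNReal.coe_le_coe, ← NNReal.coe_le_coe]
      simpa using this
    · rw [← ENNReal.coe_one, ENNReal.coe_lt_coe, ← NNReal.coe_lt_coe]; norm_num
  have ht := spectrum.pow_nnnorm_pow_one_div_tendsto_nhds_spectralRadius W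
  filter_upwards [ht.eventually (gt_mem_nhds hr), eventually_gt_atTop 0] with n hn hn0
  have hn0' : (0 : ℝ) < 1 / n := by positivity
  by_contra hlt
  have h1 : (1 : ENNReal) ≤ ‖W ^ n‖₊ := by exact_mod_cast (not_le.1 hlt).le
  exact hn.not_ge (ENNReal.one_le_rpow h1 hn0')

/-- With `w = u*` and `d = u - w`, both `u` and `w` solve the equation and commute, so `d w = d (2 -
u)`. Hence `‖d wⁿ‖ ≥ (3/2)ⁿ ‖d‖`. But the spectrum of `w` is conjugate to that of `u`, hence of
radius at most `1/2`, so `wⁿ` is eventually bounded by `1` and `d = 0`. No norm bound on `u*` is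
used. -/
theorem star_quasi_sqrt [CompleteSpace A] [StarRing A] [StarModule ℂ A] {h u : A}
    (hh : star h = h) (hu : ‖u‖ ≤ 1 / 2) (huh : u + u - u * u = h)
    (hcomm : ∀ y, Commute y h → Commute y u) : star u = u := by
  set w := star u with hw
  have hwh : w + w - w * w = h := by
    rw [← hh, ← huh]; simp [hw]
  have hcw : Commute w h := by
    rw [← hwh]
    exact ((Commute.refl w).add_right (Commute.refl w)).sub_right
      ((Commute.refl w).mul_right (Commute.refl w))
  have hwu : w * u = u * w := hcomm w hcw
  set d := u - w with hd
  have hdw : d * w = d + d - d * u := by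
    have e : u + u - u * u = w + w - w * w := huh.trans hwh.symm
    have e2 : d * w - (d + d - d * u) = (w + w - w * w) - (u + u - u * u) := by
      simp only [hd, sub_mul, hwu]; abel
    rw [e, sub_self] at e2
    exact sub_eq_zero.1 e2
  have hspec : ∀ k ∈ spectrum ℂ (w : Unitization ℂ A), ‖k‖ ≤ 1 / 2 := fun k hk => by
    have := norm_le_of_mem_spectrum_inr (mem_spectrum_star hk)
    rw [norm_star] at this
    exact this.trans hu
  set T : A → WithLp 1 (Unitization ℂ A) := fun x => WithLp.toLp 1 (x : Unitization ℂ A)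
  have hTm : ∀ x y, T (x * y) = T x * T y := fun x y => by
    apply WithLp.ofLp_injective; simp [T]
  have hTs : ∀ x y, T (x - y) = T x - T y := fun x y => by
    apply WithLp.ofLp_injective; simp [T]
  have hTa : ∀ x y, T (x + y) = T x + T y := fun x y => by
    apply WithLp.ofLp_injective; simp [T]
  have hTn : ∀ x, ‖T x‖ = ‖x‖ := WithLp.unitization_norm_inr
  have hgrow : ∀ n : ℕ, (3 / 2 : ℝ) ^ n * ‖d‖ ≤ ‖T d * T w ^ n‖ := by
    intro n
    induction n with
    | zero => simp [hTn]
    | succ n ih =>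
      set z := T d * T w ^ n
      have hc : Commute (T w) (T u) := by
        change T w * T u = T u * T w
        rw [← hTm, ← hTm, hwu]
      have e : T d * T w ^ (n + 1) = (2 : ℂ) • z - z * T u := by
        rw [pow_succ', ← mul_assoc, ← hTm, hdw, hTs, hTa, hTm, sub_mul, add_mul, two_smul,
          mul_assoc (T d) (T u), ← (hc.pow_left n).eq, ← mul_assoc]
      rw [e]
      have h1 := norm_sub_norm_le ((2 : ℂ) • z) (z * T u)
      have h2 := norm_mul_le z (T u)
      rw [norm_smul] at h1
      rw [hTn] at h2
      have h3 : ‖z‖ * ‖u‖ ≤ ‖z‖ * (1 / 2) := by gcongr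
      have h4 : ‖(2 : ℂ)‖ = 2 := by norm_num
      rw [h4] at h1
      rw [pow_succ]
      linarith
  have hev : ∀ᶠ n : ℕ in atTop, (3 / 2 : ℝ) ^ n * ‖d‖ ≤ ‖d‖ := by
    filter_upwards [eventually_norm_toLp_pow_le_one w hspec] with n hn
    refine (hgrow n).trans ((norm_mul_le _ _).trans ?_)
    rw [hTn]
    exact mul_le_of_le_one_right (norm_nonneg _) hn
  obtain ⟨n, hn, hn1⟩ := (hev.and (eventually_gt_atTop 0)).exists
  have h1 : (1 : ℝ) < (3 / 2) ^ n := one_lt_pow₀ (by norm_num) hn1.ne'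
  have hd0 : ‖d‖ = 0 := by nlinarith [norm_nonneg d]
  exact (sub_eq_zero.1 (norm_eq_zero.1 hd0)).symm

/-- **Ford's square root lemma** for Banach star algebras with a possibly discontinuous
involution. -/
theorem exists_selfAdjoint_quasi_sqrt [CompleteSpace A] [StarRing A] [StarModule ℂ A] {h : A}
    (hh : star h = h) (hn : ‖h‖ ≤ 3 / 4) : ∃ u : A, star u = u ∧ u + u - u * u = h := by
  obtain ⟨u, h1, h2, h3⟩ := exists_quasi_sqrt h hn
  exact ⟨u, star_quasi_sqrt hh h1 h2 h3, h2⟩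

end SquareRoot

/-! ### Automatic continuity of star homomorphisms. -/

section AutomaticContinuity

variable {A : Type*} [NonUnitalNormedRing A] [NormedSpace ℂ A]
  [IsScalarTower ℂ A A] [SMulCommClass ℂ A A] [CompleteSpace A] [StarRing A] [StarModule ℂ A]
  {D : Type*} [CStarAlgebra D] (π : A →⋆ₙₐ[ℂ] D)

-- Spectra shrink under homomorphisms, and norm equals spectral radius for self-adjoint elements.
-- Only `π s` has to be self-adjoint, which the closedness argument below exploits.
omit [StarModule ℂ A] in
theorem norm_map_le_of_isSelfAdjoint {s : A} (hs : IsSelfAdjoint (π s)) : ‖π s‖ ≤ ‖s‖ := by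
  let φ : Unitization ℂ A →ₐ[ℂ] D := Unitization.lift (π : A →ₙₐ[ℂ] D)
  have hφ : φ (s : Unitization ℂ A) = π s := by simp [φ]; rfl
  have h1 : spectralRadius ℂ (π s) ≤ ‖s‖₊ := by
    refine iSup₂_le fun k hk => ?_
    rw [← hφ] at hk
    have := norm_le_of_mem_spectrum_inr (AlgHom.spectrum_apply_subset φ _ hk)
    exact_mod_cast this
  rw [hs.spectralRadius_eq_nnnorm] at h1
  exact_mod_cast h1

variable [PartialOrder D] [StarOrderedRing D]

/-- If `x n → b + i c`, then `(x n - b)² + c² → 0`. Its image is self-adjoint, so tends to `0`, and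
dominates `(π c)² ≥ 0`; thus `π c = 0`. -/
theorem isClosed_setOf_isSelfAdjoint_map : IsClosed {s : A | IsSelfAdjoint (π s)} := by
  refine IsSeqClosed.isClosed fun x s hx hlim => ?_
  set b : A := (realPart s : A)
  set c : A := (imaginaryPart s : A)
  have hs : b + Complex.I • c = s := realPart_add_I_smul_imaginaryPart s
  have hb : IsSelfAdjoint b := (realPart s).2
  have hc : IsSelfAdjoint c := (imaginaryPart s).2
  have hu : ∀ n, IsSelfAdjoint (π (x n - b)) := fun n => by
    rw [map_sub]; exact (hx n).sub (hb.map π)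
  have hlim1 : Tendsto (fun n => x n - b) atTop (𝓝 (Complex.I • c)) := by
    have := hlim.sub_const b
    rwa [← hs, add_sub_cancel_left] at this
  have hlim2 : Tendsto (fun n => (x n - b) * (x n - b) + c * c) atTop (𝓝 0) := by
    have := (hlim1.mul hlim1).add_const (c * c)
    rwa [smul_mul_smul_comm, Complex.I_mul_I, neg_one_smul, neg_add_cancel] at this
  have hle : ∀ n, ‖π c‖ * ‖π c‖ ≤ ‖(x n - b) * (x n - b) + c * c‖ := fun n => by
    have h1 : IsSelfAdjoint (π ((x n - b) * (x n - b) + c * c)) := by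
      rw [map_add, map_mul, map_mul]
      exact (((hu n).commute_iff (hu n)).1 (Commute.refl _)).add
        (((hc.map π).commute_iff (hc.map π)).1 (Commute.refl _))
    refine le_trans ?_ (norm_map_le_of_isSelfAdjoint π h1)
    rw [← sq, ← (hc.map π).norm_mul_self, map_add, map_mul, map_mul]
    have e1 : 0 ≤ π c * π c := by
      have := star_mul_self_nonneg (π c)
      rwa [(hc.map π).star_eq] at this
    have e2 : 0 ≤ π (x n - b) * π (x n - b) := by
      have := star_mul_self_nonneg (π (x n - b))
      rwa [(hu n).star_eq] at this
    exact CStarAlgebra.norm_le_norm_of_nonneg_of_le e1 (le_add_of_nonneg_left e2)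
  have h0 : ‖π c‖ * ‖π c‖ ≤ 0 :=
    ge_of_tendsto' (by simpa using hlim2.norm) hle
  have hc0 : π c = 0 := norm_eq_zero.1 (by nlinarith [norm_nonneg (π c)])
  change IsSelfAdjoint (π s)
  rw [← hs, map_add, map_smul, hc0, smul_zero, add_zero]
  exact hb.map π

/-- Star homomorphisms from a Banach star algebra, with a possibly discontinuous involution, into
a C⋆-algebra are continuous. -/
theorem exists_norm_map_le : ∃ K : ℝ, 0 ≤ K ∧ ∀ x, ‖π x‖ ≤ K * ‖x‖ := by
  let S : Submodule ℝ A :=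
    { carrier := {s : A | IsSelfAdjoint (π s)}
      add_mem' := fun {a b} ha hb => by
        change IsSelfAdjoint (π (a + b))
        rw [map_add]; exact IsSelfAdjoint.add ha hb
      zero_mem' := by
        change IsSelfAdjoint (π 0)
        rw [map_zero]; exact IsSelfAdjoint.zero _
      smul_mem' := fun r a ha => by
        change IsSelfAdjoint (π (r • a))
        rw [← Complex.coe_smul, map_smul, Complex.coe_smul]
        exact IsSelfAdjoint.smul (IsSelfAdjoint.all r) ha }
  have hSc : IsClosed (S : Set A) := isClosed_setOf_isSelfAdjoint_map π
  have : CompleteSpace S := hSc.completeSpace_coe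
  let J : A →L[ℝ] A := (Complex.I • ContinuousLinearMap.id ℂ A).restrictScalars ℝ
  let F : S × S →L[ℝ] A :=
    S.subtypeL.comp (ContinuousLinearMap.fst ℝ S S) +
      J.comp (S.subtypeL.comp (ContinuousLinearMap.snd ℝ S S))
  have hF : ∀ p : S × S, F p = (p.1 : A) + Complex.I • (p.2 : A) := fun p => rfl
  have hsurj : Function.Surjective F := fun x =>
    ⟨(⟨realPart x, (realPart x).2.map π⟩, ⟨imaginaryPart x, (imaginaryPart x).2.map π⟩),
      realPart_add_I_smul_imaginaryPart x⟩
  -- The open mapping theorem yields a decomposition `b + i c` with norm control, although taking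
  -- real parts may be discontinuous.
  obtain ⟨K, hK, h⟩ := F.exists_preimage_norm_le hsurj
  refine ⟨K + K, by positivity, fun x => ?_⟩
  obtain ⟨p, rfl, hp⟩ := h x
  have h1 : ‖π p.1‖ ≤ K * ‖F p‖ :=
    (norm_map_le_of_isSelfAdjoint π p.1.2).trans ((norm_fst_le p).trans hp)
  have h2 : ‖π p.2‖ ≤ K * ‖F p‖ :=
    (norm_map_le_of_isSelfAdjoint π p.2.2).trans ((norm_snd_le p).trans hp)
  have h3 : π (F p) = π p.1 + Complex.I • π p.2 := by rw [hF, map_add, map_smul]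
  have h4 := norm_add_le (π p.1) (Complex.I • π p.2)
  rw [norm_smul, Complex.norm_I, one_mul, ← h3] at h4
  linarith

end AutomaticContinuity

/-! ### Positive sesquilinear forms: Cauchy-Schwarz and polarization. -/

section SesquilinearForms

variable {V : Type*} [AddCommGroup V] [Module ℂ V]

theorem sesqForm_conj_symm (s : V →ₗ⋆[ℂ] V →ₗ[ℂ] ℂ) (hs : ∀ v, 0 ≤ s v v) (v w : V) :
    (starRingEnd ℂ) (s w v) = s v w := by
  have him : ∀ v, (s v v).im = 0 := fun v => ((Complex.nonneg_iff.1 (hs v)).2).symm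
  have h1 := him (v + w)
  have h2 := him (v + Complex.I • w)
  simp [him] at h1 h2
  apply Complex.ext <;> simp <;> linarith

/-- The semi-inner product given by a positive semidefinite sesquilinear form. -/
abbrev preInnerProductSpaceCore (s : V →ₗ⋆[ℂ] V →ₗ[ℂ] ℂ) (hs : ∀ v, 0 ≤ s v v) :
    PreInnerProductSpace.Core ℂ V where
  inner v w := s v w
  conj_inner_symm := sesqForm_conj_symm s hs
  re_inner_nonneg v := (Complex.nonneg_iff.1 (hs v)).1
  add_left v w z := by simp
  smul_left v w c := by simp

theorem norm_sesqForm_sq_le (s : V →ₗ⋆[ℂ] V →ₗ[ℂ] ℂ) (hs : ∀ v, 0 ≤ s v v) (v w : V) :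
    ‖s v w‖ ^ 2 ≤ (s v v).re * (s w w).re := by
  have h : ‖s v w‖ * ‖s w v‖ ≤ (s v v).re * (s w w).re :=
    @InnerProductSpace.Core.inner_mul_inner_self_le ℂ V _ _ _ (preInnerProductSpaceCore s hs) v w
  rwa [← sesqForm_conj_symm s hs w v, RCLike.norm_conj, ← sq] at h

theorem sesqForm_ext {s t : V →ₗ⋆[ℂ] V →ₗ[ℂ] ℂ} (h : ∀ v, s v v = t v v) : s = t := by
  refine LinearMap.ext₂ fun v w => ?_
  have h1 := h (v + w)
  have h2 := h (v + Complex.I • w)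
  simp only [map_add, map_smul, map_smulₛₗ, LinearMap.add_apply, LinearMap.smul_apply, h,
    Complex.conj_I, smul_eq_mul] at h1 h2
  have e1 : s v w - t v w + (s w v - t w v) = 0 := by linear_combination h1
  have e2 : s v w - t v w - (s w v - t w v) = 0 := by
    have := Complex.I_mul_I
    linear_combination -Complex.I * h2 + (s v w - t v w - (s w v - t w v)) * this
  linear_combination (e1 + e2) / 2

end SesquilinearForms

/-! ### Passage to the Hilbert space completion. -/

section Representations

variable {A : Type u} [NonUnitalNormedRing A] [NormedSpace ℂ A] [StarRing A]

/-- A representation by bounded adjointable operators on a semi-inner product space, together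
with a bounded functional, extends to the Hilbert space completion. -/
theorem exists_completion_representation {V : Type u} [AddCommGroup V] [Module ℂ V]
    (s : V →ₗ⋆[ℂ] V →ₗ[ℂ] ℂ) (hs : ∀ v, 0 ≤ s v v) (T : A →ₙₐ[ℂ] Module.End ℂ V)
    (hstar : ∀ x v w, s (T (star x) v) w = s v (T x w))
    (hbdd : ∀ x, ∃ K : ℝ, ∀ v, (s (T x v) (T x v)).re ≤ K * (s v v).re)
    (φ : V →ₗ[ℂ] ℂ) (C : ℝ) (hφ : ∀ v, ‖φ v‖ ^ 2 ≤ C * (s v v).re) :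
    ∃ (H : Type u) (_ : NormedAddCommGroup H) (_ : InnerProductSpace ℂ H) (_ : CompleteSpace H)
      (j : V →ₗ[ℂ] H) (π : A →⋆ₙₐ[ℂ] (H →L[ℂ] H)) (ζ : H), DenseRange j ∧
      (∀ v w, inner ℂ (j v) (j w) = s v w) ∧ (∀ x v, π x (j v) = j (T x v)) ∧
      ∀ v, φ v = inner ℂ ζ (j v) := by
  -- The form may be degenerate; the Hausdorff completion divides out its null vectors.
  let c := preInnerProductSpaceCore s hs
  let : SeminormedAddCommGroup V := InnerProductSpace.Core.toSeminormedAddCommGroup (c := c)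
  let : InnerProductSpace ℂ V := InnerProductSpace.ofCore c
  have hinner : ∀ v w : V, inner ℂ v w = s v w := fun v w => rfl
  have hnorm : ∀ v : V, ‖v‖ ^ 2 = (s v v).re := fun v => by
    rw [← hinner]; exact norm_sq_eq_re_inner (𝕜 := ℂ) v
  have hle : ∀ x, ∃ K : ℝ, ∀ v, ‖T x v‖ ≤ K * ‖v‖ := fun x => by
    obtain ⟨K, hK⟩ := hbdd x
    refine ⟨√|K|, fun v => abs_le_of_sq_le_sq' ?_ (by positivity) |>.2⟩
    rw [mul_pow, Real.sq_sqrt (abs_nonneg _), hnorm, hnorm]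
    have h0 : 0 ≤ (s v v).re := (Complex.nonneg_iff.1 (hs v)).1
    exact (hK v).trans (by gcongr; exact le_abs_self K)
  choose K hK using hle
  let L : A → V →L[ℂ] V := fun x => (T x).mkContinuous (K x) (hK x)
  have hL : ∀ x v, L x v = T x v := fun x v => rfl
  let π : A →⋆ₙₐ[ℂ] (UniformSpace.Completion V →L[ℂ] UniformSpace.Completion V) :=
    { toFun := fun x => (L x).completion
      map_smul' := fun m x => by
        ext v
        induction v using UniformSpace.Completion.induction_on with
        | hp => exact isClosed_eq (ContinuousLinearMap.continuous _)
                  (ContinuousLinearMap.continuous _)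
        | ih v => simp [hL]
      map_zero' := by
        ext v
        induction v using UniformSpace.Completion.induction_on with
        | hp => exact isClosed_eq (ContinuousLinearMap.continuous _)
                  (ContinuousLinearMap.continuous _)
        | ih v => simpa [hL] using UniformSpace.Completion.coe_zero
      map_add' := fun x y => by
        ext v
        induction v using UniformSpace.Completion.induction_on with
        | hp => exact isClosed_eq (ContinuousLinearMap.continuous _)
                  (ContinuousLinearMap.continuous _)
        | ih v => simp [hL, UniformSpace.Completion.coe_add]
      map_mul' := fun x y => by
        ext v
        induction v using UniformSpace.Completion.induction_on with
        | hp => exact isClosed_eq (ContinuousLinearMap.continuous _)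
                  (ContinuousLinearMap.continuous _)
        | ih v => simp [hL]
      map_star' := fun x => by
        refine (ContinuousLinearMap.eq_adjoint_iff _ _).2 fun v w => ?_
        induction v, w using UniformSpace.Completion.induction_on₂ with
        | hp => apply isClosed_eq <;> fun_prop
        | ih v w => simp [hL, hinner, hstar] }
  have hφ' : ∀ v, ‖φ v‖ ≤ √|C| * ‖v‖ := fun v => by
    refine abs_le_of_sq_le_sq' ?_ (by positivity) |>.2
    rw [mul_pow, Real.sq_sqrt (abs_nonneg _), hnorm]
    have h0 : 0 ≤ (s v v).re := (Complex.nonneg_iff.1 (hs v)).1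
    exact (hφ v).trans (by gcongr; exact le_abs_self C)
  let Φ : StrongDual ℂ (UniformSpace.Completion V) :=
    (φ.mkContinuous _ hφ').extend UniformSpace.Completion.toComplL
  have hΦ : ∀ v : V, Φ v = φ v := fun v =>
    ContinuousLinearMap.extend_eq _ UniformSpace.Completion.denseRange_coe
      (UniformSpace.Completion.isUniformInducing_coe V) v
  refine ⟨UniformSpace.Completion V, inferInstance, inferInstance, inferInstance,
    (UniformSpace.Completion.toComplL : V →L[ℂ] _).toLinearMap, π,
    (InnerProductSpace.toDual ℂ _).symm Φ, UniformSpace.Completion.denseRange_coe, ?_, ?_, ?_⟩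
  · exact fun v w => UniformSpace.Completion.inner_coe v w
  · exact fun x v => ContinuousLinearMap.completion_apply_coe _ _
  · intro v
    rw [InnerProductSpace.toDual_symm_apply]
    exact (hΦ v).symm

end Representations

/-! ### Operators into the antidual. -/

section AntiDual

variable {E : Type*} [NormedAddCommGroup E] [NormedSpace ℂ E]

/-- The sesquilinear form `(y, x) ↦ B x y` of an operator into the antidual. -/
noncomputable def operatorSesqForm (B : E →L[ℂ] AntiDual E) : E →ₗ⋆[ℂ] E →ₗ[ℂ] ℂ :=
  LinearMap.mk₂'ₛₗ (starRingEnd ℂ) (RingHom.id ℂ) (fun y x => B x y)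
    (fun x y z => map_add (B z) x y) (fun c x y => map_smulₛₗ (B y) c x)
    (fun x y z => by rw [map_add, add_apply]) (fun c x y => by rw [map_smul]; rfl)

theorem norm_apply_sq_le_of_isPositiveOp {B : E →L[ℂ] AntiDual E} (hB : IsPositiveOp B) (x y : E) :
    ‖B x y‖ ^ 2 ≤ (B y y).re * (B x x).re :=
  norm_sesqForm_sq_le (operatorSesqForm B) hB y x

theorem operator_ext_of_apply_self {B B' : E →L[ℂ] AntiDual E} (h : ∀ x, B x x = B' x x) :
    B = B' := by
  have := sesqForm_ext (s := operatorSesqForm B) (t := operatorSesqForm B') h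
  ext x y
  exact LinearMap.congr_fun₂ this y x

theorem IsKreinVonNeumannExtension.unique {D : Submodule ℂ E} {T : D →ₗ[ℂ] AntiDual E}
    {B B' : E →L[ℂ] AntiDual E} (hB : IsKreinVonNeumannExtension T B)
    (hB' : IsKreinVonNeumannExtension T B') : B = B' :=
  operator_ext_of_apply_self fun x => le_antisymm (hB.2 _ hB'.1 x) (hB'.2 _ hB.1 x)

theorem AntiDual.norm_conj_le (φ : AntiDual E) : ‖φ.conj‖ ≤ ‖φ‖ :=
  ContinuousLinearMap.opNorm_le_bound _ (norm_nonneg φ) fun x => by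
    rw [AntiDual.conj_apply, norm_star]; exact φ.le_opNorm x

theorem AntiDual.tendsto_conj {ι : Type*} {l : Filter ι} {ψ : ι → AntiDual E} {φ : AntiDual E} (h : Tendsto ψ l (𝓝 φ)) :
    Tendsto (fun i => (ψ i).conj) l (𝓝 φ.conj) := by
  rw [tendsto_iff_norm_sub_tendsto_zero] at h ⊢
  refine squeeze_zero (fun _ => norm_nonneg _) (fun i => ?_) h
  have e : (ψ i).conj - φ.conj = AntiDual.conj (ψ i - φ) := by
    ext x
    simp [AntiDual.conj_apply]
  rw [e]
  exact AntiDual.norm_conj_le _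

end AntiDual

/-! ### The GNS construction on a left ideal. -/

section LeftIdeals

variable {A : Type u} [NonUnitalNormedRing A] [NormedSpace ℂ A]
  [IsScalarTower ℂ A A] [SMulCommClass ℂ A A] [StarRing A] [StarModule ℂ A]

/-- Left multiplication on a left ideal, as a representation of the algebra. -/
def leftIdealRepresentation {M : Submodule ℂ A} (hM : IsLeftIdeal M) :
    A →ₙₐ[ℂ] Module.End ℂ M where
  toFun x :=
    { toFun := fun a => ⟨x * a, hM x a a.2⟩
      map_add' := fun a b => Subtype.ext (mul_add x (a : A) b)
      map_smul' := fun c a => Subtype.ext (mul_smul_comm c x (a : A)) }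
  map_smul' c x := LinearMap.ext fun a => Subtype.ext (smul_mul_assoc c x (a : A))
  map_zero' := LinearMap.ext fun a => Subtype.ext (zero_mul (a : A))
  map_add' x y := LinearMap.ext fun a => Subtype.ext (add_mul x y (a : A))
  map_mul' x y := LinearMap.ext fun a => Subtype.ext (mul_assoc x y (a : A))

omit [StarRing A] [StarModule ℂ A] in
theorem coe_leftIdealRepresentation {M : Submodule ℂ A} (hM : IsLeftIdeal M) (x : A) (a : M) :
    (leftIdealRepresentation hM x a : A) = x * a := rfl

/-- The sesquilinear form `(y, x) ↦ F (y* x)` of a linear functional. -/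
def functionalSesqForm (F : A →ₗ[ℂ] ℂ) : A →ₗ⋆[ℂ] A →ₗ[ℂ] ℂ :=
  LinearMap.mk₂'ₛₗ (starRingEnd ℂ) (RingHom.id ℂ) (fun y x => F (star y * x))
    (fun x y z => by rw [star_add, add_mul, map_add])
    (fun c x y => by rw [star_smul, smul_mul_assoc, map_smul]; rfl)
    (fun x y z => by rw [mul_add, map_add])
    (fun c x y => by rw [mul_smul_comm, map_smul]; rfl)

/-- Formally `1 - t x* x = (1 - u)²` with `u` self-adjoint. Positivity at `a - u a ∈ M` then reads
`F (a* a) - t F ((x a)* (x a)) ≥ 0`. The factor `t` only brings the norm below `3/4`. -/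
theorem exists_re_map_star_mul_le [CompleteSpace A] {M : Submodule ℂ A} (hM : IsLeftIdeal M)
    (F : A →ₗ[ℂ] ℂ) (hF : ∀ a ∈ M, 0 ≤ F (star a * a)) (x : A) :
    ∃ K : ℝ, ∀ a ∈ M, (F (star (x * a) * (x * a))).re ≤ K * (F (star a * a)).re := by
  set h := star x * x
  set t : ℝ := 3 / 4 / (‖h‖ + 1)
  have ht : 0 < t := by positivity
  have hn : ‖(t : ℂ) • h‖ ≤ 3 / 4 := by
    rw [norm_smul, Complex.norm_real, Real.norm_of_nonneg ht.le, div_mul_eq_mul_div,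
      div_le_iff₀ (by positivity)]
    nlinarith [norm_nonneg h]
  have hsa : star ((t : ℂ) • h) = (t : ℂ) • h := by simp [h, star_smul]
  obtain ⟨u, hu, huh⟩ := exists_selfAdjoint_quasi_sqrt hsa hn
  refine ⟨t⁻¹, fun a ha => ?_⟩
  have h1 : star (a - u * a) * (a - u * a) =
      star a * a - (t : ℂ) • (star (x * a) * (x * a)) := by
    have e : (t : ℂ) • (star (x * a) * (x * a)) = star a * ((t : ℂ) • h * a) := by
      simp [h, star_mul, mul_assoc, smul_mul_assoc, mul_smul_comm]
    rw [e, ← huh]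
    simp only [star_sub, star_mul, hu, sub_mul, mul_sub, add_mul, mul_add, mul_assoc]
    abel
  have h2 := hF (a - u * a) (M.sub_mem ha (hM u a ha))
  rw [h1, map_sub, map_smul] at h2
  have h3 := (Complex.nonneg_iff.1 h2).1
  simp only [Complex.sub_re, smul_eq_mul, Complex.re_ofReal_mul] at h3
  rw [le_inv_mul_iff₀ ht]
  linarith

/-- `j`, `π` and `ζ` are the data of the Gelfand-Naimark-Segal construction for the restriction of
`F` to the left ideal `M`. -/
structure IsLeftIdealGNS {M : Submodule ℂ A} (hM : IsLeftIdeal M) (F : A →ₗ[ℂ] ℂ)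
    {H : Type*} [NormedAddCommGroup H] [InnerProductSpace ℂ H] [CompleteSpace H]
    (j : M →ₗ[ℂ] H) (π : A →⋆ₙₐ[ℂ] (H →L[ℂ] H)) (ζ : H) : Prop where
  denseRange : DenseRange j
  inner_map_map : ∀ a b : M, inner ℂ (j a) (j b) = F (star (a : A) * b)
  representation_map : ∀ x a, π x (j a) = j (leftIdealRepresentation hM x a)
  functional_eq : ∀ a : M, F a = inner ℂ ζ (j a)

theorem exists_gns_of_leftIdeal [CompleteSpace A] {M : Submodule ℂ A} (hM : IsLeftIdeal M)
    (F : A →ₗ[ℂ] ℂ) {C : ℝ} (hC : 0 ≤ C)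
    (hF : ∀ a ∈ M, ((‖F a‖ ^ 2 : ℝ) : ℂ) ≤ (C : ℂ) * F (star a * a)) :
    ∃ (H : Type u) (_ : NormedAddCommGroup H) (_ : InnerProductSpace ℂ H) (_ : CompleteSpace H)
      (j : M →ₗ[ℂ] H) (π : A →⋆ₙₐ[ℂ] (H →L[ℂ] H)) (ζ : H), IsLeftIdealGNS hM F j π ζ := by
  have hpos : ∀ a ∈ M, 0 ≤ F (star a * a) := fun a ha => by
    -- For `C = 0` division is impossible, but the hypothesis at `a* a ∈ M` gives `F (a* a) = 0`.
    rcases hC.eq_or_lt with rfl | hC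
    · have h0 := hF (star a * a) (hM _ a ha)
      rw [Complex.ofReal_zero, zero_mul, ← Complex.ofReal_zero, Complex.real_le_real] at h0
      have : ‖F (star a * a)‖ = 0 := by nlinarith [norm_nonneg (F (star a * a))]
      rw [norm_eq_zero.1 this]
    · have h1 := (Complex.zero_le_real.2 (sq_nonneg ‖F a‖)).trans (hF a ha)
      rw [Complex.nonneg_iff, Complex.re_ofReal_mul, Complex.im_ofReal_mul] at h1
      exact Complex.nonneg_iff.2 ⟨nonneg_of_mul_nonneg_right h1.1 hC,
        ((mul_eq_zero_iff_left hC.ne').1 h1.2.symm).symm⟩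
  let s : M →ₗ⋆[ℂ] M →ₗ[ℂ] ℂ := (functionalSesqForm F).domRestrict₁₂ M M
  have hs : ∀ a b : M, s a b = F (star (a : A) * b) := fun a b => rfl
  obtain ⟨H, _, _, _, j, π, ζ, h1, h2, h3, h4⟩ :=
    exists_completion_representation s (fun a => hpos a a.2) (leftIdealRepresentation hM)
      (fun x a b => by
        rw [hs, hs, coe_leftIdealRepresentation, coe_leftIdealRepresentation, star_mul, star_star,
          mul_assoc])
      (fun x => by
        obtain ⟨K, hK⟩ := exists_re_map_star_mul_le hM F hpos x
        exact ⟨K, fun a => hK a a.2⟩)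
      (F.comp M.subtype) C
      (fun a => by
        have := (Complex.le_def.1 (hF a a.2)).1
        rwa [Complex.re_ofReal_mul, Complex.ofReal_re] at this)
  exact ⟨H, _, _, _, j, π, ζ, h1, h2, h3, h4⟩

end LeftIdeals

section Representables

variable {A : Type u} [NonUnitalNormedRing A] [NormedSpace ℂ A]
  [IsScalarTower ℂ A A] [SMulCommClass ℂ A A] [StarRing A] [StarModule ℂ A]

omit [IsScalarTower ℂ A A] [SMulCommClass ℂ A A] [StarModule ℂ A] in
theorem star_mul_representation {H : Type*} [NormedAddCommGroup H] [InnerProductSpace ℂ H]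
    [CompleteSpace H] (π : A →⋆ₙₐ[ℂ] (H →L[ℂ] H)) (ζ : H) (y x : A) :
    inner ℂ ζ (π (star y * x) ζ) = inner ℂ (π y ζ) (π x ζ) := by
  rw [map_mul, map_star, ContinuousLinearMap.star_eq_adjoint, mul_apply_eq_comp,
    ContinuousLinearMap.adjoint_inner_right]

omit [IsScalarTower ℂ A A] [SMulCommClass ℂ A A] [StarModule ℂ A] in
theorem IsRepresentable.exists_norm_sq_le {g : StrongDual ℂ A} (hg : IsRepresentable g) :
    ∃ c : ℝ, 0 ≤ c ∧ ∀ x, ‖g x‖ ^ 2 ≤ c * (g (star x * x)).re := by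
  obtain ⟨-, H, _, _, _, π, ζ, h⟩ := hg
  refine ⟨‖ζ‖ ^ 2, by positivity, fun x => ?_⟩
  rw [h, h, star_mul_representation, ← RCLike.re_eq_complex_re, inner_self_eq_norm_sq, ← mul_pow]
  gcongr
  exact norm_inner_le_norm _ _

end Representables

/-! ### Orbit maps, coefficient functionals and strong convergence. -/

section OrbitMaps

variable {A : Type*} [NonUnitalNormedRing A] [NormedSpace ℂ A]
  [IsScalarTower ℂ A A] [SMulCommClass ℂ A A] [CompleteSpace A] [StarRing A] [StarModule ℂ A]
  {H : Type*} [NormedAddCommGroup H] [InnerProductSpace ℂ H] [CompleteSpace H]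
  (π : A →⋆ₙₐ[ℂ] (H →L[ℂ] H)) (ζ : H)

/-- The orbit map `x ↦ π x ζ` of a vector under a star representation. -/
noncomputable def orbitMap : A →L[ℂ] H where
  toFun x := π x ζ
  map_add' x y := by rw [map_add, add_apply]
  map_smul' c x := by rw [map_smul]; rfl
  cont := by
    obtain ⟨K, -, hK⟩ := exists_norm_map_le π
    let f : A →+ H := ⟨⟨fun x => π x ζ, by rw [map_zero]; rfl⟩, fun x y => by simp⟩
    refine AddMonoidHomClass.continuous_of_bound f (K * ‖ζ‖) fun x => ?_
    refine ((π x).le_opNorm ζ).trans ?_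
    rw [mul_right_comm]
    gcongr
    exact hK x

theorem orbitMap_apply (x : A) : orbitMap π ζ x = π x ζ := rfl

/-- The functional `x ↦ (η | π x ζ)` in the antidual, as a function of the vector `η`. -/
noncomputable def coefficientMap : H →L[ℂ] AntiDual A :=
  (innerSLFlip ℂ).bilinearComp (ContinuousLinearMap.id ℂ H) (orbitMap π ζ)

theorem coefficientMap_apply (η : H) (x : A) :
    coefficientMap π ζ η x = inner ℂ (π x ζ) η := rfl

theorem conj_coefficientMap_apply (x : A) :
    (coefficientMap π ζ ζ).conj x = inner ℂ ζ (π x ζ) := by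
  rw [AntiDual.conj_apply, coefficientMap_apply]
  exact inner_conj_symm _ _

theorem tendsto_representation_of_dense {ι : Type*} {l : Filter ι} {e : ι → A}
    (he : ∃ K : ℝ, ∀ i, ‖e i‖ ≤ K) {S : Set H} (hS : Dense S)
    (h : ∀ v ∈ S, Tendsto (fun i => π (e i) v) l (𝓝 v)) (η : H) :
    Tendsto (fun i => π (e i) η) l (𝓝 η) := by
  obtain ⟨K, hK0, hK⟩ := exists_norm_map_le π
  obtain ⟨R, hR⟩ := he
  have hb : ∀ i, ‖π (e i)‖ ≤ K * |R| := fun i =>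
    (hK _).trans (by gcongr; exact (hR i).trans (le_abs_self R))
  set L := K * |R|
  have hL : 0 ≤ L := by positivity
  rw [Metric.tendsto_nhds]
  intro ε hε
  -- In the three-term estimate `‖η - v‖` enters with total weight `L + 1`.
  obtain ⟨v, hvS, hv⟩ := hS.exists_dist_lt η (ε := ε / 2 / (L + 1)) (by positivity)
  filter_upwards [Metric.tendsto_nhds.1 (h v hvS) (ε / 2) (by positivity)] with i hi
  rw [dist_eq_norm] at hi hv ⊢
  rw [lt_div_iff₀ (by positivity)] at hv
  have e1 : π (e i) η - η = π (e i) (η - v) + (π (e i) v - v) - (η - v) := by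
    rw [map_sub]; abel
  have h1 : ‖π (e i) (η - v)‖ ≤ L * ‖η - v‖ := (π (e i)).le_of_opNorm_le (hb i) _
  have h2 := norm_sub_le (π (e i) (η - v) + (π (e i) v - v)) (η - v)
  have h3 := norm_add_le (π (e i) (η - v)) (π (e i) v - v)
  rw [← e1] at h2
  linarith

end OrbitMaps

/-! ### Norms and rigidity of the cyclic vector. -/

namespace IsLeftIdealGNS

variable {A : Type*} [NonUnitalNormedRing A] [NormedSpace ℂ A]
  [IsScalarTower ℂ A A] [SMulCommClass ℂ A A] [StarRing A]
  {M : Submodule ℂ A} {hM : IsLeftIdeal M} {F : A →ₗ[ℂ] ℂ}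
  {H : Type*} [NormedAddCommGroup H] [InnerProductSpace ℂ H] [CompleteSpace H]
  {j : M →ₗ[ℂ] H} {π : A →⋆ₙₐ[ℂ] (H →L[ℂ] H)} {ζ : H}

theorem inner_representation_map (h : IsLeftIdealGNS hM F j π ζ) (x : A) (a : M) :
    inner ℂ (π x ζ) (j a) = F (star x * a) := by
  rw [← ContinuousLinearMap.adjoint_inner_right, ← ContinuousLinearMap.star_eq_adjoint,
    ← map_star, h.representation_map, ← h.functional_eq, coe_leftIdealRepresentation]

/-- Both sides have inner product `F (a* b)` with every `j b`. So `ζ` stands in for the image of a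
unit. -/
theorem representation_vector (h : IsLeftIdealGNS hM F j π ζ) (a : M) : π a ζ = j a :=
  h.denseRange.eq_of_inner_left ℂ fun b => by
    rw [h.inner_representation_map, h.inner_map_map]

theorem norm_sq_le (h : IsLeftIdealGNS hM F j π ζ) {x : A} {c : ℝ} (hc : 0 ≤ c)
    (hx : ∀ a ∈ M, ‖F (star x * a)‖ ^ 2 ≤ (F (star a * a)).re * c) : ‖π x ζ‖ ^ 2 ≤ c := by
  have key : ∀ v : H, ‖inner ℂ (π x ζ) v‖ ^ 2 ≤ ‖v‖ ^ 2 * c := fun v => by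
    refine h.denseRange.induction_on v (isClosed_le (by fun_prop) (by fun_prop)) fun a => ?_
    rw [h.inner_representation_map, ← inner_self_eq_norm_sq (𝕜 := ℂ) (j a), h.inner_map_map]
    exact hx a a.2
  have h1 := key (π x ζ)
  rw [inner_self_eq_norm_sq_to_K, norm_pow, RCLike.norm_ofReal, abs_norm] at h1
  rcases (sq_nonneg ‖π x ζ‖).eq_or_lt with h0 | h0
  · rwa [← h0]
  · rw [sq (‖π x ζ‖ ^ 2)] at h1
    exact le_of_mul_le_mul_left h1 h0

theorem exists_tendsto (h : IsLeftIdealGNS hM F j π ζ) (η : H) :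
    ∃ a : ℕ → M, Tendsto (fun n => j (a n)) atTop (𝓝 η) := by
  obtain ⟨v, hv, hlim⟩ := mem_closure_iff_seq_limit.1 (h.denseRange η)
  choose a ha using hv
  exact ⟨a, by simpa only [ha] using hlim⟩

/-- Representable extensions whose quadratic form is dominated by that of the cyclic vector
coincide with the vector functional. -/
theorem eq_of_le (h : IsLeftIdealGNS hM F j π ζ) {g : StrongDual ℂ A} (hg : IsRepresentable g)
    (hgF : ∀ a ∈ M, g a = F a) (hle : ∀ x, (g (star x * x)).re ≤ ‖π x ζ‖ ^ 2) (x : A) :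
    g x = inner ℂ ζ (π x ζ) := by
  obtain ⟨c, hc, hgc⟩ := hg.exists_norm_sq_le
  -- Since `π (a n) ζ = j (a n) → ζ`, representability and the domination give `g (x - x a n) → 0`.
  -- As `x a n ∈ M`, the values of `F` there determine `g x`.
  obtain ⟨a, ha⟩ := h.exists_tendsto ζ
  have h1 : Tendsto (fun n => π x (j (a n))) atTop (𝓝 (π x ζ)) :=
    ((π x).continuous.tendsto ζ).comp ha
  have h2 : ∀ n, π (x * a n) ζ = π x (j (a n)) := fun n => by
    rw [map_mul, mul_apply_eq_comp, h.representation_vector]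
  have h3 : Tendsto (fun n => c * ‖π x ζ - π x (j (a n))‖ ^ 2) atTop (𝓝 0) := by
    have := ((tendsto_const_nhds (x := π x ζ)).sub h1).norm.pow 2 |>.const_mul c
    simpa using this
  have h4 : Tendsto (fun n => ‖g (x - x * a n)‖ ^ 2) atTop (𝓝 0) := by
    refine squeeze_zero (fun n => by positivity) (fun n => ?_) h3
    refine (hgc _).trans ?_
    gcongr
    rw [← h2, ← sub_apply, ← map_sub]
    exact hle _
  have h5 : Tendsto (fun n => ‖g (x - x * a n)‖) atTop (𝓝 0) := by
    have := h4.sqrt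
    simpa [Real.sqrt_sq (norm_nonneg _)] using this
  have h6 : ∀ n, g (x - x * a n) = g x - inner ℂ ζ (π x (j (a n))) := fun n => by
    rw [map_sub, hgF _ (hM x _ (a n).2), h.representation_map,
      ← h.functional_eq, coe_leftIdealRepresentation]
  simp only [h6] at h5
  have h7 : Tendsto (fun n => inner ℂ ζ (π x (j (a n)))) atTop (𝓝 (g x)) := by
    rw [tendsto_iff_norm_sub_tendsto_zero]
    simpa only [norm_sub_rev] using h5
  exact tendsto_nhds_unique h7 ((tendsto_const_nhds (x := ζ)).inner h1)

end IsLeftIdealGNS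

/-! ### Minimality, uniqueness and convergence. -/

namespace IsLeftIdealGNS

variable {A : Type u} [NonUnitalNormedRing A] [NormedSpace ℂ A] [CompleteSpace A]
  [IsScalarTower ℂ A A] [SMulCommClass ℂ A A] [StarRing A] [StarModule ℂ A]
  {M : Submodule ℂ A} {hM : IsLeftIdeal M} {F : A →ₗ[ℂ] ℂ} {f : M →ₗ[ℂ] ℂ}
  {H : Type u} [NormedAddCommGroup H] [InnerProductSpace ℂ H] [CompleteSpace H]
  {j : M →ₗ[ℂ] H} {π : A →⋆ₙₐ[ℂ] (H →L[ℂ] H)} {ζ : H}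

omit [StarModule ℂ A] [CompleteSpace A] [IsScalarTower ℂ A A] [SMulCommClass ℂ A A] in
theorem ofReal_norm_sq_eq_inner (x : A) :
    inner ℂ (π x ζ) (π x ζ) = ((‖π x ζ‖ ^ 2 : ℝ) : ℂ) := by
  rw [inner_self_eq_norm_sq_to_K]; norm_cast

theorem continuous_functional (h : IsLeftIdealGNS hM F j π ζ) (a : M) :
    Continuous fun x : A => F (star x * a) := by
  have e : (fun x : A => F (star x * a)) = coefficientMap π ζ (j a) :=
    funext fun x => (h.inner_representation_map x a).symm
  rw [e]
  exact (coefficientMap π ζ (j a)).continuous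

theorem isKreinVonNeumannExtension (h : IsLeftIdealGNS hM F j π ζ) (hFf : ∀ a : M, F a = f a)
    (hcont : ∀ a : M, Continuous fun x : A => f ⟨star x * a, hM (star x) a a.2⟩) :
    IsKreinVonNeumannExtension (inducedOperator hM f hcont)
      ((coefficientMap π ζ).comp (orbitMap π ζ)) := by
  have hind : ∀ (a : M) (x : A), inducedOperator hM f hcont a x = F (star x * a) :=
    fun a x => (hFf ⟨star x * a, hM (star x) a a.2⟩).symm
  have hself : ∀ x, (coefficientMap π ζ).comp (orbitMap π ζ) x x = ((‖π x ζ‖ ^ 2 : ℝ) : ℂ) :=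
    fun x => ofReal_norm_sq_eq_inner x
  refine ⟨⟨fun x => ?_, fun a => ?_⟩, fun B hB x => ?_⟩
  · rw [hself]
    exact Complex.zero_le_real.2 (by positivity)
  · ext x
    rw [hind, ← h.inner_representation_map, ← h.representation_vector]
    rfl
  · obtain ⟨h0, him⟩ := Complex.nonneg_iff.1 (hB.1 x)
    rw [hself, Complex.le_def, Complex.ofReal_re, Complex.ofReal_im]
    refine ⟨h.norm_sq_le h0 fun a ha => ?_, him⟩
    have hBa : ∀ y, B a y = F (star y * a) := fun y => by
      rw [← hind ⟨a, ha⟩, ← hB.2 ⟨a, ha⟩]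
    rw [← hBa, ← hBa, mul_comm]
    -- Cauchy-Schwarz for the competitor `B`: `|⟨B a, x⟩|² ≤ ⟨B a, a⟩ ⟨B x, x⟩`, where `B a` is
    -- prescribed by `F`.
    exact norm_apply_sq_le_of_isPositiveOp hB.1 a x

theorem isMinimalRepresentableExtension (h : IsLeftIdealGNS hM F j π ζ)
    (hFf : ∀ a : M, F a = f a) :
    IsMinimalRepresentableExtension f (coefficientMap π ζ ζ).conj := by
  have hself : ∀ x, (coefficientMap π ζ ζ).conj (star x * x) = ((‖π x ζ‖ ^ 2 : ℝ) : ℂ) :=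
    fun x => by
      rw [conj_coefficientMap_apply, star_mul_representation, ofReal_norm_sq_eq_inner]
  refine ⟨⟨⟨fun x => ?_, H, _, _, _, π, ζ, conj_coefficientMap_apply π ζ⟩, fun a => ?_⟩,
    fun g hg x => ?_⟩
  · rw [hself]
    exact Complex.zero_le_real.2 (by positivity)
  · rw [conj_coefficientMap_apply, h.representation_vector, ← h.functional_eq, hFf]
  · obtain ⟨h0, him⟩ := Complex.nonneg_iff.1 (hg.1.1 x)
    rw [hself, Complex.le_def, Complex.ofReal_re, Complex.ofReal_im]
    refine ⟨h.norm_sq_le h0 fun a ha => ?_, him⟩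
    have hgF : ∀ y, g (star y * a) = F (star y * a) := fun y =>
      (hg.2 ⟨star y * a, hM _ a ha⟩).trans (hFf ⟨star y * a, hM _ a ha⟩).symm
    rw [← hgF, ← hgF]
    exact norm_sesqForm_sq_le (functionalSesqForm (g : A →ₗ[ℂ] ℂ)) hg.1.1 x a |>.trans_eq
      (mul_comm _ _)

/-- Polarization would recover `g` only on products, so representability is used once more, through
`eq_of_le`. -/
theorem eq_of_isMinimalRepresentableExtension (h : IsLeftIdealGNS hM F j π ζ)
    (hFf : ∀ a : M, F a = f a) {g : StrongDual ℂ A} (hg : IsMinimalRepresentableExtension f g) :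
    g = (coefficientMap π ζ ζ).conj := by
  ext x
  rw [conj_coefficientMap_apply]
  refine h.eq_of_le hg.1.1 (fun a ha => (hg.1.2 ⟨a, ha⟩).trans (hFf ⟨a, ha⟩).symm) (fun y => ?_) x
  have := hg.2 _ (h.isMinimalRepresentableExtension hFf).1 y
  rw [conj_coefficientMap_apply, star_mul_representation, ofReal_norm_sq_eq_inner] at this
  exact (Complex.le_def.1 this).1

/-- On the dense range of `j`, `π (e i) (j a) = π (e i a) ζ → π a ζ = j a`; boundedness of the net
does the rest. -/
theorem tendsto_representation (h : IsLeftIdealGNS hM F j π ζ) {ι : Type*} {l : Filter ι}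
    {e : ι → A} (he_bdd : ∃ K : ℝ, ∀ i, ‖e i‖ ≤ K)
    (he : ∀ a ∈ M, Tendsto (fun i => e i * a) l (𝓝 a)) (η : H) :
    Tendsto (fun i => π (e i) η) l (𝓝 η) := by
  refine tendsto_representation_of_dense π he_bdd h.denseRange ?_ η
  rintro _ ⟨a, rfl⟩
  have h1 := ((orbitMap π ζ).continuous.tendsto (a : A)).comp (he a a.2)
  rw [orbitMap_apply, h.representation_vector] at h1
  refine h1.congr fun i => ?_
  rw [Function.comp_apply, orbitMap_apply, map_mul, mul_apply_eq_comp, h.representation_vector]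

end IsLeftIdealGNS

theorem theorem5p6 {𝔄 : Type u} [NonUnitalNormedRing 𝔄] [NormedSpace ℂ 𝔄]
    [IsScalarTower ℂ 𝔄 𝔄] [SMulCommClass ℂ 𝔄 𝔄] [CompleteSpace 𝔄] [StarRing 𝔄] [StarModule ℂ 𝔄]
    (M : Submodule ℂ 𝔄) (hM : IsLeftIdeal M) (f : M →ₗ[ℂ] ℂ)
    (C : ℝ) (hC : 0 ≤ C)
    (hf : ∀ a : M,
      ((‖f a‖ ^ 2 : ℝ) : ℂ) ≤ (C : ℂ) * f ⟨star (a : 𝔄) * a, hM (star (a : 𝔄)) a a.2⟩)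
    {ι : Type*} [Preorder ι] [IsDirected ι (· ≤ ·)] [Nonempty ι]
    (e : ι → 𝔄) (he_bdd : ∃ K : ℝ, ∀ i, ‖e i‖ ≤ K)
    (he : ∀ a ∈ M, Tendsto (fun i => e i * a) atTop (𝓝 a)) :
    ∃ hcont : ∀ a : M, Continuous fun x : 𝔄 => f ⟨star x * a, hM (star x) a a.2⟩,
      (∃! A_N : 𝔄 →L[ℂ] AntiDual 𝔄,
        IsKreinVonNeumannExtension (inducedOperator hM f hcont) A_N) ∧
      (∃! f_N : StrongDual ℂ 𝔄, IsMinimalRepresentableExtension f f_N) ∧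
      ∀ (A_N : 𝔄 →L[ℂ] AntiDual 𝔄) (f_N : StrongDual ℂ 𝔄),
        IsKreinVonNeumannExtension (inducedOperator hM f hcont) A_N →
        IsMinimalRepresentableExtension f f_N →
        (∃ φ : AntiDual 𝔄, Tendsto (fun i => A_N (e i)) atTop (𝓝 φ) ∧ f_N = φ.conj) ∧
        Tendsto (fun i => (A_N (e i)).conj) atTop (𝓝 f_N) := by
  -- `F` is an arbitrary linear extension, possibly discontinuous; it only spares membership proofs,
  -- and its values off `M` play no role.
  obtain ⟨F, hF⟩ := f.exists_extend
  have hFf : ∀ a : M, F a = f a := fun a => LinearMap.congr_fun hF a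
  obtain ⟨H, _, _, _, j, π, ζ, h⟩ := exists_gns_of_leftIdeal hM F hC fun a ha => by
    have := hf ⟨a, ha⟩
    rwa [← hFf, ← hFf] at this
  have hcont : ∀ a : M, Continuous fun x : 𝔄 => f ⟨star x * a, hM (star x) a a.2⟩ := fun a =>
    (h.continuous_functional a).congr fun x => hFf ⟨star x * a, hM (star x) a a.2⟩
  have hA := h.isKreinVonNeumannExtension hFf hcont
  have hg := h.isMinimalRepresentableExtension hFf
  refine ⟨hcont, ⟨_, hA, fun B hB => hB.unique hA⟩,
    ⟨_, hg, fun g hg' => h.eq_of_isMinimalRepresentableExtension hFf hg'⟩, ?_⟩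
  intro A_N f_N hA_N hf_N
  obtain rfl := hA_N.unique hA
  obtain rfl := h.eq_of_isMinimalRepresentableExtension hFf hf_N
  have hlim : Tendsto (fun i => (coefficientMap π ζ).comp (orbitMap π ζ) (e i)) atTop
      (𝓝 (coefficientMap π ζ ζ)) :=
    ((coefficientMap π ζ).continuous.tendsto ζ).comp (h.tendsto_representation he_bdd he ζ)
  exact ⟨⟨_, hlim, rfl⟩, AntiDual.tendsto_conj hlim⟩
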